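/- Let $a_1,a_2,b_{11},b_{22},\sigma_1,\sigma_2>0$ and $b_{12},b_{21}\ge 0$, and put $A=(a_1,a_2)^{\mathrm T}$, $B=\begin{pmatrix} b_{11} & -b_{12}\\ -b_{21} & b_{22}\end{pmatrix}$, $\kappa=\frac{b_{12}b_{21}}{b_{11}b_{22}}$ and $D=[0,\infty)^2$. For $\lambda\in D$ let $v_t(\lambda)=(v_1(t,\lambda),v_2(t,\lambda))^{\mathrm T}$, $t\ge 0$, be the solution of $$\begin{aligned}\partial_t v_1(t,\lambda)&=-b_{11}v_1(t,\lambda)+b_{12}v_2(t,\lambda)-\tfrac{\sigma_1^2}{2}v_1(t,\lambda)^2,\\ \partial_t v_2(t,\lambda)&=b_{21}v_1(t,\lambda)-b_{22}v_2(t,\lambda)-\tfrac{\sigma_2^2}{2}v_2(t,\lambda)^2,\end{aligned}\qquad v_0(\lambda)=\lambda.$$ Let $(Q_t)_{t\ge 0}$ be the transition semigroup of the two-type continuous-state branching process with immigration with these parameters, that is, the semigroup of Markov kernels on $D$ with $$\int_D e^{-\langle y,\lambda\rangle}\,Q_t(x,dy)=\exp\Big\{-\langle x,v_t(\lambda)\rangle-\int_0^t\langle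 A,v_s(\lambda)\rangle\,ds\Big\},\qquad \lambda,x\in D,\ t\ge 0 .$$ Both eigenvalues of $B$ are positive if and only if $\kappa<1$. If this is the case, then $(Q_t)_{t\ge 0}$ has a unique stationary distribution $Q_\infty$ (a probability measure on $D$ with $Q_\infty Q_t=Q_\infty$ for all $t\ge 0$); for every $\lambda\in D$ the integral $\int_0^\infty\langle A,v_s(\lambda)\rangle\,ds$ is finite and $$\int_D e^{-\langle y,\lambda\rangle}\,Q_\infty(dy)=\exp\Big\{-\int_0^\infty\langle A,v_s(\lambda)\rangle\,ds\Big\};$$ and for every $x\in D$, $Q_t(x,\cdot)\to Q_\infty$ weakly as $t\to\infty$. -/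

import Mathlib

open MeasureTheory ProbabilityTheory Filter Set
open scoped NNReal Topology

noncomputable section

namespace TwoTypeCBI

/-- The state space `[0, ∞)²`, with its usual topology and Borel σ-algebra. -/
abbrev D : Type := Fin 2 → ℝ≥0

/-- The Euclidean pairing on `ℝ²`. -/
def pairing (x y : Fin 2 → ℝ) : ℝ := x 0 * y 0 + x 1 * y 1

/-- A point of `[0, ∞)²` seen as a vector of `ℝ²`. -/
def toVec (x : D) : Fin 2 → ℝ := fun i => (x i : ℝ)

/-- Parameters `(a₁, a₂, b₁₁, b₁₂, b₂₁, b₂₂, σ₁, σ₂)` in `(0, ∞)³ × [0, ∞)² × (0, ∞)³`. -/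
structure Params where
  a₁ : ℝ
  a₂ : ℝ
  b₁₁ : ℝ
  b₁₂ : ℝ
  b₂₁ : ℝ
  b₂₂ : ℝ
  σ₁ : ℝ
  σ₂ : ℝ
  a₁_pos : 0 < a₁
  a₂_pos : 0 < a₂
  b₁₁_pos : 0 < b₁₁
  b₁₂_nonneg : 0 ≤ b₁₂
  b₂₁_nonneg : 0 ≤ b₂₁
  b₂₂_pos : 0 < b₂₂
  σ₁_pos : 0 < σ₁
  σ₂_pos : 0 < σ₂

namespace Params

/-- The immigration vector. -/
def A (p : Params) : Fin 2 → ℝ := ![p.a₁, p.a₂]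

/-- The drift matrix. -/
def B (p : Params) : Matrix (Fin 2) (Fin 2) ℝ :=
  !![p.b₁₁, -p.b₁₂; -p.b₂₁, p.b₂₂]

def κ (p : Params) : ℝ := p.b₁₂ * p.b₂₁ / (p.b₁₁ * p.b₂₂)

/-- The branching mechanism `(φ₁, φ₂)`. -/
def φ (p : Params) (l : Fin 2 → ℝ) : Fin 2 → ℝ :=
  ![p.b₁₁ * l 0 - p.b₁₂ * l 1 + p.σ₁ ^ 2 / 2 * l 0 ^ 2,
    -p.b₂₁ * l 0 + p.b₂₂ * l 1 + p.σ₂ ^ 2 / 2 * l 1 ^ 2]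

/-- All eigenvalues of `B` are positive. Since `b₁₂ b₂₁ ≥ 0`, both roots of the characteristic
polynomial of `B` are real, so that its real eigenvalues are all its eigenvalues. -/
def EigenvaluesPositive (p : Params) : Prop :=
  ∀ μ : ℝ, Module.End.HasEigenvalue (Matrix.toLin' p.B) μ → 0 < μ

/-- `v t l` (for `t ≥ 0`) solves `∂ₜ v = -φ(v)` on `[0, ∞)` with `v 0 l = l`, for every
`l ∈ [0, ∞)²`. The derivative at `t = 0` is one-sided. -/
structure IsCumulantSolution (p : Params) (v : ℝ → D → Fin 2 → ℝ) : Prop where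
  init : ∀ l : D, v 0 l = toVec l
  deriv : ∀ (l : D) (t : ℝ), 0 ≤ t → ∀ i : Fin 2,
    HasDerivWithinAt (fun s => v s l i) (-(p.φ (v t l) i)) (Ici 0) t

end Params

/-- A (conservative) transition semigroup on a measurable space. -/
structure TransitionSemigroup (E : Type*) [MeasurableSpace E] where
  kernel : ℝ≥0 → Kernel E E
  markov : ∀ t, IsMarkovKernel (kernel t)
  zero : kernel 0 = Kernel.id
  add : ∀ s t, kernel (s + t) = kernel t ∘ₖ kernel s

namespace TransitionSemigroup

variable {E : Type*} [MeasurableSpace E]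

/-- The probability measure `Q_t(x, ·)`. -/
def law (Q : TransitionSemigroup E) (t : ℝ≥0) (x : E) : ProbabilityMeasure E :=
  ⟨Q.kernel t x, (Q.markov t).isProbabilityMeasure x⟩

/-- `ρ` is a stationary distribution: `ρ Q_t = ρ` for every `t ≥ 0`. -/
def IsStationary (Q : TransitionSemigroup E) (ρ : ProbabilityMeasure E) : Prop :=
  ∀ t, (Q.kernel t).Invariant (ρ : Measure E)

end TransitionSemigroup

/-- The Laplace transform of a probability measure on `[0, ∞)²`. -/
def laplace (ρ : ProbabilityMeasure D) (l : D) : ℝ :=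
  ∫ y, Real.exp (-(pairing (toVec y) (toVec l))) ∂(ρ : Measure D)

/-- `Q` is the transition semigroup of the two-type CBI-process with parameters `p`, where `v`
is the solution of the associated differential equations. -/
structure IsCBISemigroup (p : Params) (v : ℝ → D → Fin 2 → ℝ) (Q : TransitionSemigroup D) :
    Prop where
  solution : p.IsCumulantSolution v
  laplace_eq : ∀ (t : ℝ≥0) (x l : D),
    laplace (Q.law t x) l =
      Real.exp (-(pairing (toVec x) (v t l)) - ∫ s in (0 : ℝ)..t, pairing p.A (v s l))

end TwoTypeCBI

end

/-! Positivity of the spectrum is the condition `det B > 0`, since the trace of `B` is positive.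
Under it a positive linear functional of `v_t` decays exponentially, because the quadratic terms
only help (`exists_exp_decay`). Hence `v_t(λ) → 0`, and `∫ ⟨A, v_s(λ)⟩ ds` converges with a bound
linear in `λ`.

From any initial law, the Laplace transform at time `t` therefore tends to `exp (-∫₀^∞ ⟨A, v_s(λ)⟩
ds)`, which forgets that law (`tendsto_laplace_evolve`). This settles uniqueness. For existence, the
linear bounds make `{Q_t(x, ·)}` tight (`isTightMeasureSet_law`); Prokhorov's theorem and the
injectivity of the Laplace transform turn the convergence into weak convergence, and the semigroup
law makes the limit stationary. -/

namespace TwoTypeCBI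

/-! ### Laplace transforms, tightness and weak convergence on `[0, ∞)²` -/

section Laplace

lemma continuous_pairing_toVec (l : Fin 2 → ℝ) : Continuous fun y : D => pairing (toVec y) l := by
  unfold pairing toVec
  fun_prop

lemma pairing_toVec_nonneg (y l : D) : 0 ≤ pairing (toVec y) (toVec l) := by
  unfold pairing toVec
  positivity

/-- The bounded continuous function `y ↦ exp (-⟨y, l⟩)` on `[0, ∞)²`. -/
noncomputable def expNeg (l : D) : BoundedContinuousFunction D ℝ :=
  BoundedContinuousFunction.ofNormedAddCommGroup
    (fun y => Real.exp (-(pairing (toVec y) (toVec l))))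
    (Real.continuous_exp.comp (continuous_pairing_toVec _).neg) 1 (fun y => by
      rw [Real.norm_eq_abs, Real.abs_exp, Real.exp_le_one_iff, neg_nonpos]
      exact pairing_toVec_nonneg y l)

lemma expNeg_apply (l y : D) : expNeg l y = Real.exp (-(pairing (toVec y) (toVec l))) := rfl

lemma expNeg_le_one (l y : D) : expNeg l y ≤ 1 := by
  rw [expNeg_apply, Real.exp_le_one_iff, neg_nonpos]
  exact pairing_toVec_nonneg y l

lemma expNeg_zero : expNeg 0 = 1 := by
  ext y
  simp [expNeg_apply, pairing, toVec]

lemma expNeg_add (l m : D) : expNeg (l + m) = expNeg l * expNeg m := by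
  ext y
  simp only [expNeg_apply, BoundedContinuousFunction.coe_mul, Pi.mul_apply, ← Real.exp_add]
  congr 1
  simp only [pairing, toVec, Pi.add_apply, NNReal.coe_add]
  ring

/-- The algebra spanned by the functions `expNeg l`. -/
noncomputable def expAlgebra : StarSubalgebra ℝ (BoundedContinuousFunction D ℝ) where
  toSubalgebra := Algebra.adjoin ℝ (range expNeg)
  star_mem' := fun {a} ha => by
    have : star a = a := by ext y; simp
    rwa [this]

lemma separatesPoints_expAlgebra :
    (expAlgebra.map (BoundedContinuousFunction.toContinuousMapStarₐ ℝ)).SeparatesPoints := by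
  intro x y hxy
  obtain ⟨i, hi⟩ := Function.ne_iff.mp hxy
  refine ⟨expNeg (Pi.single i 1), ⟨_, ⟨expNeg (Pi.single i 1), ?_, rfl⟩, rfl⟩, fun h => hi ?_⟩
  · exact Algebra.subset_adjoin (mem_range_self _)
  · have h1 := Real.exp_injective h
    fin_cases i <;> simpa [pairing, toVec] using h1

/-- Exponentials contain `1` and are closed under products, so the algebra they generate is only
their linear span. Testing against it thus amounts to testing Laplace transforms. -/
lemma mem_span_of_mem_expAlgebra {g : BoundedContinuousFunction D ℝ} (hg : g ∈ expAlgebra) :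
    g ∈ Submodule.span ℝ (range expNeg) := by
  have h1 : g ∈ Subalgebra.toSubmodule (Algebra.adjoin ℝ (range expNeg)) := hg
  rw [Algebra.adjoin_eq_span] at h1
  refine Submodule.span_mono ?_ h1
  intro f hf
  induction hf using Submonoid.closure_induction with
  | mem f hf => exact hf
  | one => exact ⟨0, expNeg_zero⟩
  | mul f g _ _ hf hg =>
    obtain ⟨l, rfl⟩ := hf
    obtain ⟨m, rfl⟩ := hg
    exact ⟨l + m, expNeg_add l m⟩

/-- For a tight family, convergence of the Laplace transforms implies weak convergence. -/
lemma tendsto_of_tendsto_laplace {ι : Type*} {F : Filter ι} {μ : ι → ProbabilityMeasure D}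
    {μ₀ : ProbabilityMeasure D} (htight : IsTightMeasureSet {(μ n : Measure D) | n})
    (h : ∀ l, Tendsto (fun n => laplace (μ n) l) F (𝓝 (laplace μ₀ l))) :
    Tendsto μ F (𝓝 μ₀) := by
  refine ProbabilityMeasure.tendsto_of_tight_of_separatesPoints ℝ htight
    separatesPoints_expAlgebra fun g hg => ?_
  have hspan := mem_span_of_mem_expAlgebra hg
  clear hg
  induction hspan using Submodule.span_induction with
  | mem f hf =>
    obtain ⟨l, rfl⟩ := hf
    exact h l
  | zero => simpa using tendsto_const_nhds
  | add f g _ _ hf hg =>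
    have hadd : ∀ ν : ProbabilityMeasure D,
        ∫ x, (f + g) x ∂(ν : Measure D) = ∫ x, f x ∂(ν : Measure D) + ∫ x, g x ∂(ν : Measure D) :=
      fun ν => integral_add (f.integrable _) (g.integrable _)
    simp only [hadd]
    exact hf.add hg
  | smul a f _ hf =>
    have hsmul : ∀ ν : ProbabilityMeasure D,
        ∫ x, (a • f) x ∂(ν : Measure D) = a * ∫ x, f x ∂(ν : Measure D) :=
      fun ν => integral_const_mul a _
    simp only [hsmul]
    exact hf.const_mul a

/-- A probability measure on `[0, ∞)²` is determined by its Laplace transform. -/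
lemma laplace_injective : Function.Injective laplace := by
  intro μ ν h
  -- The constant sequence `μ` is tight and has the Laplace transforms of `ν`, so it converges to
  -- both `μ` and `ν`.
  have htight : IsTightMeasureSet {(((fun _ => μ) n : ProbabilityMeasure D) : Measure D) | n : ℕ} :=
    (isTightMeasureSet_singleton (μ := (μ : Measure D))).subset (by rintro _ ⟨n, rfl⟩; rfl)
  exact tendsto_nhds_unique (tendsto_const_nhds (x := μ) (f := (atTop : Filter ℕ)))
    (tendsto_of_tendsto_laplace htight fun l => by simp [h])

lemma tendsto_laplace {ι : Type*} {F : Filter ι} {μ : ι → ProbabilityMeasure D}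
    {μ₀ : ProbabilityMeasure D} (h : Tendsto μ F (𝓝 μ₀)) (l : D) :
    Tendsto (fun n => laplace (μ n) l) F (𝓝 (laplace μ₀ l)) :=
  ProbabilityMeasure.tendsto_iff_forall_integral_tendsto.mp h (expNeg l)

/-- Lévy's continuity theorem for Laplace transforms, for tight families. -/
lemma exists_tendsto_of_tendsto_laplace {ι : Type*} {F : Filter ι} [F.NeBot]
    {μ : ι → ProbabilityMeasure D} {f : D → ℝ}
    (htight : IsTightMeasureSet {(μ n : Measure D) | n})
    (h : ∀ l, Tendsto (fun n => laplace (μ n) l) F (𝓝 (f l))) :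
    ∃ μ₀, laplace μ₀ = f ∧ Tendsto μ F (𝓝 μ₀) := by
  have hcomp : IsCompact (closure (range μ)) := by
    refine isCompact_closure_of_isTightMeasureSet (htight.subset ?_)
    rintro _ ⟨_, ⟨n, rfl⟩, rfl⟩
    exact ⟨n, rfl⟩
  -- Compactness gives a limit along an ultrafilter finer than `F.map μ`; its Laplace transform must
  -- be `f`, and this upgrades to convergence along `F`.
  obtain ⟨μ₀, -, hμ₀⟩ := hcomp.ultrafilter_le_nhds (Ultrafilter.of (F.map μ))
    (le_principal_iff.mpr (Ultrafilter.of_le (F.map μ)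
      (mem_of_superset (mem_map.mpr (univ_mem' mem_range_self)) subset_closure)))
  have hlap : laplace μ₀ = f := by
    ext l
    have h1 : Tendsto (fun ν => laplace ν l) (F.map μ) (𝓝 (f l)) := h l
    exact tendsto_nhds_unique (tendsto_laplace (μ := id) hμ₀ l)
      (h1.mono_left (Ultrafilter.of_le _))
  subst hlap
  exact ⟨μ₀, rfl, tendsto_of_tendsto_laplace htight h⟩

/-- Markov's inequality for `1 - exp (-⟨y, l⟩)`: outside the box some `ε * y i` exceeds `1`, so this
function is at least `1 - 1/e > 1/2`. -/
lemma measureReal_compl_Icc_le (μ : ProbabilityMeasure D) {ε : ℝ≥0} (hε : 0 < ε) :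
    (μ : Measure D).real (Icc 0 (fun _ => ε⁻¹))ᶜ ≤ 2 * (1 - laplace μ fun _ => ε) := by
  set l : D := fun _ => ε
  have hint : ∫ y, (1 - expNeg l y) ∂(μ : Measure D) = 1 - laplace μ l := by
    rw [integral_sub (integrable_const _) ((expNeg l).integrable _)]
    simp [laplace, expNeg_apply]
  have h1 := mul_meas_ge_le_integral_of_nonneg (μ := (μ : Measure D))
    (f := fun y => 1 - expNeg l y) (ae_of_all _ fun y => sub_nonneg.mpr (expNeg_le_one l y))
    ((integrable_const _).sub ((expNeg l).integrable _)) (1 / 2)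
  rw [hint] at h1
  have h2 : (Icc 0 (fun _ => ε⁻¹) : Set D)ᶜ ⊆ {y | 1 / 2 ≤ 1 - expNeg l y} := by
    intro y hy
    have hsum : 1 ≤ pairing (toVec y) (toVec l) := by
      have : ∃ i, ε⁻¹ < y i := by
        by_contra! hcon
        exact hy ⟨fun i => zero_le, hcon⟩
      obtain ⟨i, hi⟩ := this
      have hi' : 1 ≤ (y i : ℝ) * ε := by
        have : (ε : ℝ)⁻¹ < y i := by exact_mod_cast hi
        rw [inv_lt_iff_one_lt_mul₀ (by exact_mod_cast hε)] at this
        exact this.le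
      have h0 : ∀ j, 0 ≤ (y j : ℝ) * ε := fun j => by positivity
      unfold pairing toVec
      fin_cases i
      · exact le_add_of_le_of_nonneg hi' (h0 1)
      · exact le_add_of_nonneg_of_le (h0 0) hi'
    have hexp : expNeg l y ≤ Real.exp (-1) := Real.exp_le_exp.mpr (neg_le_neg hsum)
    have := Real.exp_neg_one_lt_d9
    simp only [mem_ofPred_eq]
    linarith
  have h3 := measureReal_mono (μ := (μ : Measure D)) h2
  linarith

lemma isTightMeasureSet_of_laplace {ι : Type*} {μ : ι → ProbabilityMeasure D} {M : ℝ}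
    (h : ∀ n (ε : ℝ≥0), 1 - laplace (μ n) (fun _ => ε) ≤ M * ε) :
    IsTightMeasureSet {(μ n : Measure D) | n} := by
  rw [isTightMeasureSet_iff_exists_isCompact_measure_compl_le]
  intro δ hδ
  rcases eq_or_ne δ ⊤ with rfl | hδ'
  · exact ⟨∅, isCompact_empty, fun _ _ => le_top⟩
  lift δ to ℝ≥0 using hδ'
  have hδ0 : 0 < δ := by exact_mod_cast hδ
  -- Chosen so that the tail bound `2 * M * ε` is at most `δ`; the `+ 1` keeps the denominator
  -- positive.
  set ε : ℝ≥0 := δ / (2 * (M.toNNReal + 1)) with hε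
  have hε0 : 0 < ε := by positivity
  refine ⟨Icc 0 fun _ => ε⁻¹, isCompact_Icc, ?_⟩
  rintro _ ⟨n, rfl⟩
  rw [← ENNReal.toReal_le_toReal (measure_ne_top _ _) ENNReal.coe_ne_top]
  refine (measureReal_compl_Icc_le (μ n) hε0).trans ?_
  have h1 := h n ε
  have h2 : (ε : ℝ) * (2 * (max M 0 + 1)) = δ := by
    rw [hε]
    push_cast [Real.coe_toNNReal']
    field_simp
  have h3 : M * ε ≤ max M 0 * ε := mul_le_mul_of_nonneg_right (le_max_left _ _) ε.2
  have h4 : (0 : ℝ) ≤ ε := ε.2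
  simp only [ENNReal.coe_toReal]
  nlinarith

end Laplace

end TwoTypeCBI

/-! ### The spectrum of `B` and exponential decay of the cumulants -/

namespace TwoTypeCBI

namespace Params

variable (p : Params)

lemma det_B : p.B.det = p.b₁₁ * p.b₂₂ - p.b₁₂ * p.b₂₁ := by
  simp [B, Matrix.det_fin_two]

lemma κ_lt_one_iff : p.κ < 1 ↔ 0 < p.B.det := by
  rw [κ, div_lt_one (mul_pos p.b₁₁_pos p.b₂₂_pos), det_B, sub_pos]

lemma hasEigenvalue_B_iff (μ : ℝ) :
    Module.End.HasEigenvalue (Matrix.toLin' p.B) μ ↔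
      μ ^ 2 - (p.b₁₁ + p.b₂₂) * μ + p.B.det = 0 := by
  rw [Module.End.hasEigenvalue_iff_isRoot_charpoly, Matrix.charpoly_toLin',
    Matrix.charpoly_fin_two, Polynomial.IsRoot.def]
  have : p.B.trace = p.b₁₁ + p.b₂₂ := by simp [B, Matrix.trace_fin_two]
  simp [this]

/-- If `det B ≤ 0`, the discriminant is nonnegative and the smaller root of the characteristic
polynomial is at most `0`. If `det B > 0`, the positive trace makes that polynomial positive on
`(-∞, 0]`. -/
lemma eigenvaluesPositive_iff : p.EigenvaluesPositive ↔ p.κ < 1 := by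
  have h₁ := p.b₁₁_pos
  have h₂ := p.b₂₂_pos
  rw [κ_lt_one_iff]
  constructor
  · intro h
    by_contra! hdet
    have hnonneg : 0 ≤ (p.b₁₁ + p.b₂₂) ^ 2 - 4 * p.B.det := by nlinarith [sq_nonneg (p.b₁₁ + p.b₂₂)]
    have hsq := Real.sq_sqrt hnonneg
    have hle : p.b₁₁ + p.b₂₂ ≤ √((p.b₁₁ + p.b₂₂) ^ 2 - 4 * p.B.det) :=
      Real.le_sqrt_of_sq_le (by linarith)
    have hpos := h ((p.b₁₁ + p.b₂₂ - √((p.b₁₁ + p.b₂₂) ^ 2 - 4 * p.B.det)) / 2)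
      ((p.hasEigenvalue_B_iff _).mpr (by linear_combination (1 / 4) * hsq))
    linarith
  · intro hdet μ hμ
    rw [hasEigenvalue_B_iff] at hμ
    by_contra! hle
    nlinarith [sq_nonneg μ]

variable {p} {v : ℝ → D → Fin 2 → ℝ}

lemma IsCumulantSolution.continuousOn (hv : p.IsCumulantSolution v) (l : D) (i : Fin 2) :
    ContinuousOn (fun s => v s l i) (Ici 0) :=
  fun t ht => (hv.deriv l t ht i).continuousWithinAt

lemma IsCumulantSolution.hasDerivAt (hv : p.IsCumulantSolution v) (l : D) (i : Fin 2) {t : ℝ}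
    (ht : 0 < t) : HasDerivAt (fun s => v s l i) (-(p.φ (v t l) i)) t :=
  (hv.deriv l t ht.le i).hasDerivAt (Ici_mem_nhds ht)

/-- Nonnegative solutions decay exponentially if `det B > 0`. The Lyapunov function is `⟨w, v⟩`
with `Bᵀ w = det B • (1, 1)`. -/
lemma IsCumulantSolution.exists_exp_decay (hv : p.IsCumulantSolution v) (hdet : 0 < p.B.det)
    (hnonneg : ∀ l t, 0 ≤ t → ∀ i, 0 ≤ v t l i) :
    ∃ K c : ℝ, 0 < K ∧ 0 < c ∧ ∀ (l : D) (t : ℝ), 0 ≤ t →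
      v t l 0 + v t l 1 ≤ K * (l 0 + l 1) * Real.exp (-c * t) := by
  have h₁ := p.b₁₁_pos
  have h₂ := p.b₂₂_pos
  have h₃ := p.b₁₂_nonneg
  have h₄ := p.b₂₁_nonneg
  set w₁ := p.b₂₂ + p.b₂₁ with hw₁
  set w₂ := p.b₁₁ + p.b₁₂ with hw₂
  have hw₁0 : 0 < w₁ := by positivity
  have hw₂0 : 0 < w₂ := by positivity
  -- Since each weight is at most `w₁ + w₂`, this rate gives `c * ⟨w, v⟩ ≤ det B * (v₁ + v₂)`, so
  -- `⟨w, v⟩ * exp (c * t)` is nonincreasing.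
  set c := p.B.det / (w₁ + w₂) with hc
  have hcw : c * (w₁ + w₂) = p.B.det := div_mul_cancel₀ _ (by positivity)
  have hc0 : 0 < c := by positivity
  set m := min w₁ w₂
  have hm0 : 0 < m := lt_min hw₁0 hw₂0
  have hm₁ : m ≤ w₁ := min_le_left _ _
  have hm₂ : m ≤ w₂ := min_le_right _ _
  refine ⟨(w₁ + w₂) / m, c, by positivity, hc0, fun l t ht => ?_⟩
  set g : ℝ → ℝ := fun s => (w₁ * v s l 0 + w₂ * v s l 1) * Real.exp (c * s) with hg
  have hderiv : ∀ s, 0 < s → HasDerivAt g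
      ((w₁ * -(p.φ (v s l) 0) + w₂ * -(p.φ (v s l) 1)) * Real.exp (c * s) +
        (w₁ * v s l 0 + w₂ * v s l 1) * (Real.exp (c * s) * (c * 1))) s := fun s hs =>
    (((hv.hasDerivAt l 0 hs).const_mul w₁).add ((hv.hasDerivAt l 1 hs).const_mul w₂)).mul
      ((hasDerivAt_id s).const_mul c).exp
  have hanti : AntitoneOn g (Ici 0) := by
    refine antitoneOn_of_deriv_nonpos (convex_Ici 0) ?_ ?_ ?_
    · exact ((continuousOn_const.mul (hv.continuousOn l 0)).add
        (continuousOn_const.mul (hv.continuousOn l 1))).mul (by fun_prop)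
    · intro s hs
      rw [interior_Ici] at hs
      exact (hderiv s hs).differentiableAt.differentiableWithinAt
    · intro s hs
      rw [interior_Ici] at hs
      rw [(hderiv s hs).deriv]
      have hv₁ := hnonneg l s (le_of_lt hs) 0
      have hv₂ := hnonneg l s (le_of_lt hs) 1
      have hφ : w₁ * -(p.φ (v s l) 0) + w₂ * -(p.φ (v s l) 1) =
          -(p.B.det * (v s l 0 + v s l 1)) -
            (w₁ * (p.σ₁ ^ 2 / 2 * v s l 0 ^ 2) + w₂ * (p.σ₂ ^ 2 / 2 * v s l 1 ^ 2)) := by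
        simp only [φ, det_B, hw₁, hw₂, Matrix.cons_val_zero, Matrix.cons_val_one]
        ring
      have hq : 0 ≤ w₁ * (p.σ₁ ^ 2 / 2 * v s l 0 ^ 2) + w₂ * (p.σ₂ ^ 2 / 2 * v s l 1 ^ 2) := by
        positivity
      have hL : c * (w₁ * v s l 0 + w₂ * v s l 1) ≤ p.B.det * (v s l 0 + v s l 1) := by
        rw [← hcw]
        have : 0 ≤ c * (w₁ * v s l 1 + w₂ * v s l 0) := by positivity
        linarith
      rw [hφ]
      have := Real.exp_pos (c * s)
      nlinarith
  have hgt : g t ≤ g 0 := hanti self_mem_Ici ht ht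
  simp only [hg, hv.init, toVec, mul_zero, Real.exp_zero, mul_one] at hgt
  have hv₁ := hnonneg l t ht 0
  have hv₂ := hnonneg l t ht 1
  have hexp : Real.exp (-(c * t)) * Real.exp (c * t) = 1 := by
    rw [← Real.exp_add]
    simp
  have hl₁ : (0 : ℝ) ≤ l 0 := (l 0).2
  have hl₂ : (0 : ℝ) ≤ l 1 := (l 1).2
  have key : m * (v t l 0 + v t l 1) * Real.exp (c * t) ≤ (w₁ + w₂) * (l 0 + l 1) := by
    calc m * (v t l 0 + v t l 1) * Real.exp (c * t)
        ≤ (w₁ * v t l 0 + w₂ * v t l 1) * Real.exp (c * t) := by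
          gcongr
          nlinarith
      _ ≤ w₁ * l 0 + w₂ * l 1 := hgt
      _ ≤ (w₁ + w₂) * (l 0 + l 1) := by nlinarith [mul_nonneg hw₁0.le hl₂, mul_nonneg hw₂0.le hl₁]
  calc v t l 0 + v t l 1
      = (m * (v t l 0 + v t l 1) * Real.exp (c * t)) / m * Real.exp (-c * t) := by
        rw [neg_mul]
        field_simp
        linear_combination -(v t l 0 + v t l 1) * hexp
    _ ≤ ((w₁ + w₂) * (l 0 + l 1)) / m * Real.exp (-c * t) := by gcongr
    _ = _ := by ring

end Params

end TwoTypeCBI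

/-! ### Evolution of laws and the stationary distribution -/

namespace TwoTypeCBI

lemma laplace_le_one (ρ : ProbabilityMeasure D) (l : D) : laplace ρ l ≤ 1 := by
  have := integral_mono ((expNeg l).integrable (ρ : Measure D)) (integrable_const 1)
    (expNeg_le_one l)
  simpa [laplace, expNeg_apply] using this

lemma tendsto_laplace_zero (ρ : ProbabilityMeasure D) {ι : Type*} {F : Filter ι}
    [F.IsCountablyGenerated] {u : ι → D} (hu : Tendsto u F (𝓝 0)) :
    Tendsto (fun n => laplace ρ (u n)) F (𝓝 1) := by
  have h1 : (1 : ℝ) = ∫ y, expNeg 0 y ∂(ρ : Measure D) := by simp [expNeg_zero]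
  rw [h1]
  refine tendsto_integral_filter_of_dominated_convergence (fun _ => 1)
    (Eventually.of_forall fun n => (expNeg (u n)).continuous.aestronglyMeasurable)
    (Eventually.of_forall fun n => ae_of_all _ fun y => ?_) (integrable_const _)
    (ae_of_all _ fun y => ?_)
  · rw [Real.norm_eq_abs, Real.abs_exp]
    exact expNeg_le_one (u n) y
  · have hcont : Continuous fun l : D => Real.exp (-(pairing (toVec y) (toVec l))) := by
      unfold pairing toVec
      fun_prop
    exact (hcont.tendsto 0).comp hu

namespace TransitionSemigroup

variable (Q : TransitionSemigroup D)

/-- The law `ρ Q_t`. -/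
noncomputable def evolve (t : ℝ≥0) (ρ : ProbabilityMeasure D) : ProbabilityMeasure D :=
  ⟨(ρ : Measure D).bind (Q.kernel t), by have := Q.markov t; infer_instance⟩

lemma isStationary_iff (ρ : ProbabilityMeasure D) : Q.IsStationary ρ ↔ ∀ t, Q.evolve t ρ = ρ :=
  forall_congr' fun t => (Subtype.ext_iff (a1 := Q.evolve t ρ) (a2 := ρ)).symm

lemma law_add (s t : ℝ≥0) (x : D) : Q.law (s + t) x = Q.evolve t (Q.law s x) := by
  apply Subtype.ext
  simp only [law, evolve, Q.add, Kernel.comp_apply, ProbabilityMeasure.coe_mk]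

lemma laplace_evolve (t : ℝ≥0) (ρ : ProbabilityMeasure D) (l : D) :
    laplace (Q.evolve t ρ) l = ∫ x, laplace (Q.law t x) l ∂(ρ : Measure D) := by
  -- Viewing `ρ` as a constant kernel makes `ρ Q_t` a composition of kernels.
  have h := Kernel.integral_comp (κ := Kernel.const Unit (ρ : Measure D)) (η := Q.kernel t)
    (a := ()) (f := expNeg l)
  rw [Kernel.comp_apply, Kernel.const_apply] at h
  exact h ((expNeg l).integrable (Q.evolve t ρ : Measure D))

end TransitionSemigroup

namespace IsCBISemigroup

variable {p : Params} {v : ℝ → D → Fin 2 → ℝ} {Q : TransitionSemigroup D}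

/-- This comes from the semigroup rather than the differential equation: if `v t l i < 0`, starting
at `n` times the `i`-th unit vector would give a Laplace transform above `1` for large `n`. -/
lemma cumulant_nonneg (hQ : IsCBISemigroup p v Q) (l : D) (t : ℝ) (ht : 0 ≤ t) (i : Fin 2) :
    0 ≤ v t l i := by
  lift t to ℝ≥0 using ht
  by_contra! hneg
  set c := ∫ s in (0 : ℝ)..t, pairing p.A (v s l)
  obtain ⟨n, hn⟩ := exists_nat_gt (c / -(v t l i))
  rw [div_lt_iff₀ (neg_pos.mpr hneg)] at hn
  have h1 := laplace_le_one (Q.law t (Pi.single i (n : ℝ≥0))) l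
  rw [hQ.laplace_eq, Real.exp_le_one_iff] at h1
  have h2 : pairing (toVec (Pi.single i (n : ℝ≥0))) (v t l) = n * v t l i := by
    fin_cases i <;> simp [pairing, toVec]
  rw [h2] at h1
  linarith

/-- The point `v t l` of `[0, ∞)²`. -/
noncomputable def flow (v : ℝ → D → Fin 2 → ℝ) (t : ℝ) (l : D) : D := fun i => (v t l i).toNNReal

lemma toVec_flow (hQ : IsCBISemigroup p v Q) (l : D) {t : ℝ} (ht : 0 ≤ t) :
    toVec (flow v t l) = v t l :=
  funext fun i => Real.coe_toNNReal _ (hQ.cumulant_nonneg l t ht i)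

/-- `Q_t` maps an exponential to a multiple of the exponential at `v_t(l)`, so evolving a law just
substitutes the flow into its Laplace transform, up to a factor independent of the law. -/
lemma laplace_evolve (hQ : IsCBISemigroup p v Q) (t : ℝ≥0) (ρ : ProbabilityMeasure D) (l : D) :
    laplace (Q.evolve t ρ) l =
      Real.exp (-∫ s in (0 : ℝ)..t, pairing p.A (v s l)) * laplace ρ (flow v t l) := by
  rw [Q.laplace_evolve, laplace, ← integral_const_mul]
  congr 1 with x
  rw [hQ.laplace_eq, hQ.toVec_flow l t.coe_nonneg, ← Real.exp_add]
  congr 1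
  ring

lemma continuousOn_pairing (hQ : IsCBISemigroup p v Q) (l : D) :
    ContinuousOn (fun s => pairing p.A (v s l)) (Ici 0) :=
  (continuousOn_const.mul (hQ.solution.continuousOn l 0)).add
    (continuousOn_const.mul (hQ.solution.continuousOn l 1))

lemma pairing_A_nonneg (hQ : IsCBISemigroup p v Q) (l : D) {s : ℝ} (hs : 0 ≤ s) :
    0 ≤ pairing p.A (v s l) :=
  add_nonneg (mul_nonneg p.a₁_pos.le (hQ.cumulant_nonneg l s hs 0))
    (mul_nonneg p.a₂_pos.le (hQ.cumulant_nonneg l s hs 1))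

lemma pairing_A_le (hQ : IsCBISemigroup p v Q) (l : D) {s : ℝ} (hs : 0 ≤ s) :
    pairing p.A (v s l) ≤ (p.a₁ + p.a₂) * (v s l 0 + v s l 1) := by
  have h₁ := mul_nonneg p.a₁_pos.le (hQ.cumulant_nonneg l s hs 1)
  have h₂ := mul_nonneg p.a₂_pos.le (hQ.cumulant_nonneg l s hs 0)
  simp only [pairing, Params.A, Matrix.cons_val_zero, Matrix.cons_val_one]
  linarith

lemma exists_exp_decay (hQ : IsCBISemigroup p v Q) (hdet : 0 < p.B.det) :
    ∃ K c : ℝ, 0 < K ∧ 0 < c ∧ ∀ (l : D) (t : ℝ), 0 ≤ t →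
      v t l 0 + v t l 1 ≤ K * (l 0 + l 1) * Real.exp (-c * t) :=
  hQ.solution.exists_exp_decay hdet hQ.cumulant_nonneg

lemma tendsto_cumulant (hQ : IsCBISemigroup p v Q) (hdet : 0 < p.B.det) (l : D) (i : Fin 2) :
    Tendsto (fun t => v t l i) atTop (𝓝 0) := by
  obtain ⟨K, c, -, hc, hbound⟩ := hQ.exists_exp_decay hdet
  have hlim : Tendsto (fun t => K * (l 0 + l 1) * Real.exp (-c * t)) atTop (𝓝 0) := by
    have h1 : Tendsto (fun t : ℝ => Real.exp (-c * t)) atTop (𝓝 0) :=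
      Real.tendsto_exp_atBot.comp (tendsto_id.const_mul_atTop_of_neg (neg_neg_of_pos hc))
    simpa using h1.const_mul (K * (l 0 + l 1))
  refine tendsto_of_tendsto_of_tendsto_of_le_of_le' tendsto_const_nhds hlim ?_ ?_
  · filter_upwards [eventually_ge_atTop 0] with t ht using hQ.cumulant_nonneg l t ht i
  · filter_upwards [eventually_ge_atTop 0] with t ht
    have h₁ := hQ.cumulant_nonneg l t ht 0
    have h₂ := hQ.cumulant_nonneg l t ht 1
    refine le_trans ?_ (hbound l t ht)
    fin_cases i
    · exact le_add_of_nonneg_right h₂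
    · exact le_add_of_nonneg_left h₁

lemma tendsto_flow (hQ : IsCBISemigroup p v Q) (hdet : 0 < p.B.det) (l : D) :
    Tendsto (fun t => flow v t l) atTop (𝓝 0) := by
  refine tendsto_pi_nhds.mpr fun i => ?_
  have := (continuous_real_toNNReal.tendsto 0).comp (hQ.tendsto_cumulant hdet l i)
  simpa [flow, Function.comp_def] using this

/-- The integral of `⟨A, v_s(l)⟩` over `(0, ∞)` converges, and is at most linear in `l`. -/
lemma exists_integral_bound (hQ : IsCBISemigroup p v Q) (hdet : 0 < p.B.det) :
    ∃ M : ℝ, ∀ l : D, IntegrableOn (fun s : ℝ => pairing p.A (v s l)) (Ioi 0) ∧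
      ∫ s in Ioi (0 : ℝ), pairing p.A (v s l) ≤ M * (l 0 + l 1) := by
  obtain ⟨K, c, hK, hc, hbound⟩ := hQ.exists_exp_decay hdet
  have ha : 0 < p.a₁ + p.a₂ := add_pos p.a₁_pos p.a₂_pos
  have hexp := integrableOn_exp_mul_Ioi (neg_neg_of_pos hc) 0
  have hle : ∀ l : D, ∀ s ∈ Ioi (0 : ℝ), pairing p.A (v s l) ≤
      (p.a₁ + p.a₂) * (K * (l 0 + l 1)) * Real.exp (-c * s) := by
    intro l s hs
    rw [mul_assoc]
    exact (hQ.pairing_A_le l (le_of_lt hs)).trans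
      (mul_le_mul_of_nonneg_left (hbound l s (le_of_lt hs)) ha.le)
  have hint : ∀ l : D, IntegrableOn (fun s : ℝ => pairing p.A (v s l)) (Ioi 0) := by
    intro l
    refine Integrable.mono' (hexp.const_mul ((p.a₁ + p.a₂) * (K * (l 0 + l 1))))
      (((hQ.continuousOn_pairing l).mono Ioi_subset_Ici_self).aestronglyMeasurable
        measurableSet_Ioi) ?_
    filter_upwards [ae_restrict_mem measurableSet_Ioi] with s hs
    rw [Real.norm_of_nonneg (hQ.pairing_A_nonneg l (le_of_lt hs))]
    exact hle l s hs
  refine ⟨(p.a₁ + p.a₂) * K * ∫ s in Ioi (0 : ℝ), Real.exp (-c * s), fun l => ⟨hint l, ?_⟩⟩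
  calc ∫ s in Ioi (0 : ℝ), pairing p.A (v s l)
      ≤ ∫ s in Ioi (0 : ℝ), (p.a₁ + p.a₂) * (K * (l 0 + l 1)) * Real.exp (-c * s) :=
        setIntegral_mono_on (hint l) (hexp.const_mul _) measurableSet_Ioi (hle l)
    _ = _ := by
        rw [integral_const_mul]
        ring

lemma integrableOn_pairing (hQ : IsCBISemigroup p v Q) (hdet : 0 < p.B.det) (l : D) :
    IntegrableOn (fun s : ℝ => pairing p.A (v s l)) (Ioi 0) :=
  ((hQ.exists_integral_bound hdet).choose_spec l).1

lemma tendsto_integral (hQ : IsCBISemigroup p v Q) (hdet : 0 < p.B.det) (l : D) :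
    Tendsto (fun t : ℝ≥0 => ∫ s in (0 : ℝ)..t, pairing p.A (v s l)) atTop
      (𝓝 (∫ s in Ioi (0 : ℝ), pairing p.A (v s l))) :=
  intervalIntegral_tendsto_integral_Ioi 0 (hQ.integrableOn_pairing hdet l)
    (NNReal.tendsto_coe_atTop.mpr tendsto_id)

/-- Every initial law evolves to the same limit, on the level of Laplace transforms. -/
lemma tendsto_laplace_evolve (hQ : IsCBISemigroup p v Q) (hdet : 0 < p.B.det)
    (ρ : ProbabilityMeasure D) (l : D) :
    Tendsto (fun t : ℝ≥0 => laplace (Q.evolve t ρ) l) atTop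
      (𝓝 (Real.exp (-∫ s in Ioi (0 : ℝ), pairing p.A (v s l)))) := by
  simp only [hQ.laplace_evolve]
  have h1 := (Real.continuous_exp.tendsto _).comp (hQ.tendsto_integral hdet l).neg
  have h2 := tendsto_laplace_zero ρ
    ((hQ.tendsto_flow hdet l).comp (NNReal.tendsto_coe_atTop.mpr tendsto_id))
  simpa using h1.mul h2

lemma tendsto_laplace_law (hQ : IsCBISemigroup p v Q) (hdet : 0 < p.B.det) (x l : D) :
    Tendsto (fun t : ℝ≥0 => laplace (Q.law t x) l) atTop
      (𝓝 (Real.exp (-∫ s in Ioi (0 : ℝ), pairing p.A (v s l)))) := by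
  refine (hQ.tendsto_laplace_evolve hdet (Q.law 0 x) l).congr fun t => ?_
  rw [← Q.law_add, zero_add]

/-- At `l = (ε, ε)` both terms of the exponent are linear in `ε`, uniformly in `t`, and `1 - exp
(-u) ≤ u`. The factor `2` in the constant is `l 0 + l 1 = 2 * ε`. -/
lemma isTightMeasureSet_law (hQ : IsCBISemigroup p v Q) (hdet : 0 < p.B.det) (x : D) :
    IsTightMeasureSet {(Q.law t x : Measure D) | t} := by
  obtain ⟨K, c, hK, hc, hbound⟩ := hQ.exists_exp_decay hdet
  obtain ⟨M, hM⟩ := hQ.exists_integral_bound hdet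
  refine isTightMeasureSet_of_laplace (M := 2 * ((x 0 + x 1) * K + M)) fun t ε => ?_
  set l : D := fun _ => ε
  have hv₀ := hQ.cumulant_nonneg l t t.2 0
  have hv₁ := hQ.cumulant_nonneg l t t.2 1
  have hx₀ : (0 : ℝ) ≤ x 0 := (x 0).2
  have hx₁ : (0 : ℝ) ≤ x 1 := (x 1).2
  have hsum : v t l 0 + v t l 1 ≤ K * (ε + ε) := by
    refine (hbound l t t.2).trans (mul_le_of_le_one_right (by positivity) ?_)
    rw [Real.exp_le_one_iff, neg_mul, neg_nonpos]
    exact mul_nonneg hc.le t.2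
  have hpair : pairing (toVec x) (v t l) ≤ (x 0 + x 1) * (K * (ε + ε)) := by
    refine le_trans ?_ (mul_le_mul_of_nonneg_left hsum (add_nonneg hx₀ hx₁))
    simp only [pairing, toVec]
    linarith [mul_nonneg hx₀ hv₁, mul_nonneg hx₁ hv₀]
  have hint : ∫ s in (0 : ℝ)..t, pairing p.A (v s l) ≤ M * (ε + ε) := by
    rw [intervalIntegral.integral_of_le t.coe_nonneg]
    refine le_trans (setIntegral_mono_set (hM l).1 ?_ ?_) (hM l).2
    · filter_upwards [ae_restrict_mem measurableSet_Ioi] with s hs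
      exact hQ.pairing_A_nonneg l (le_of_lt hs)
    · exact (Ioc_subset_Ioi_self).eventuallyLE
  rw [hQ.laplace_eq]
  have := Real.add_one_le_exp
    (-(pairing (toVec x) (v t l)) - ∫ s in (0 : ℝ)..t, pairing p.A (v s l))
  linarith

/-- Let `s → ∞` in `Q_{s+t} = Q_s Q_t`. The explicit Laplace formula passes to the limit on the
right, in place of a Feller argument. -/
lemma stationary_of_tendsto (hQ : IsCBISemigroup p v Q) {μ : ProbabilityMeasure D} {x : D}
    (h : Tendsto (fun t : ℝ≥0 => Q.law t x) atTop (𝓝 μ)) : Q.IsStationary μ := by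
  rw [Q.isStationary_iff]
  intro t
  refine laplace_injective (funext fun l => ?_)
  have h1 : Tendsto (fun s : ℝ≥0 => laplace (Q.law (s + t) x) l) atTop (𝓝 (laplace μ l)) :=
    tendsto_laplace (h.comp (tendsto_atTop_mono (fun _ => le_self_add) tendsto_id)) l
  simp only [Q.law_add, hQ.laplace_evolve] at h1
  rw [hQ.laplace_evolve]
  exact tendsto_nhds_unique ((tendsto_laplace h _).const_mul _) h1

/-- The Laplace transform of `ρ Q_t` is constant in `t`, so it equals its universal limit. -/
lemma laplace_of_isStationary (hQ : IsCBISemigroup p v Q) (hdet : 0 < p.B.det)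
    {ρ : ProbabilityMeasure D} (hρ : Q.IsStationary ρ) (l : D) :
    laplace ρ l = Real.exp (-∫ s in Ioi (0 : ℝ), pairing p.A (v s l)) := by
  have h := hQ.tendsto_laplace_evolve hdet ρ l
  simp only [(Q.isStationary_iff ρ).mp hρ] at h
  exact tendsto_nhds_unique tendsto_const_nhds h

end IsCBISemigroup

end TwoTypeCBI

theorem theorem2p2 (p : TwoTypeCBI.Params)
    (v : ℝ → TwoTypeCBI.D → Fin 2 → ℝ)
    (Q : TwoTypeCBI.TransitionSemigroup TwoTypeCBI.D)
    (hQ : TwoTypeCBI.IsCBISemigroup p v Q) :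
    (p.EigenvaluesPositive ↔ p.κ < 1) ∧
    (p.EigenvaluesPositive →
      ∃ Qinf : ProbabilityMeasure TwoTypeCBI.D,
        (Q.IsStationary Qinf ∧
          ∀ ρ : ProbabilityMeasure TwoTypeCBI.D, Q.IsStationary ρ → ρ = Qinf) ∧
        (∀ l : TwoTypeCBI.D,
          IntegrableOn (fun s : ℝ => TwoTypeCBI.pairing p.A (v s l)) (Ioi 0) ∧
          TwoTypeCBI.laplace Qinf l =
            Real.exp (-∫ s in Ioi (0 : ℝ), TwoTypeCBI.pairing p.A (v s l))) ∧
        (∀ x : TwoTypeCBI.D, Tendsto (fun t : ℝ≥0 => Q.law t x) atTop (𝓝 Qinf))) := by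
  refine ⟨p.eigenvaluesPositive_iff, fun hpos => ?_⟩
  have hdet : 0 < p.B.det := p.κ_lt_one_iff.mp (p.eigenvaluesPositive_iff.mp hpos)
  -- The starting point `0` is arbitrary: the limiting transform does not depend on it.
  obtain ⟨μ, hμ, hlim⟩ := TwoTypeCBI.exists_tendsto_of_tendsto_laplace
    (hQ.isTightMeasureSet_law hdet 0) (hQ.tendsto_laplace_law hdet 0)
  refine ⟨μ, ⟨hQ.stationary_of_tendsto hlim, fun ρ hρ => ?_⟩, fun l => ?_, fun x => ?_⟩
  · exact TwoTypeCBI.laplace_injective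
      (hμ ▸ funext fun l => hQ.laplace_of_isStationary hdet hρ l)
  · exact ⟨hQ.integrableOn_pairing hdet l, congrFun hμ l⟩
  · refine TwoTypeCBI.tendsto_of_tendsto_laplace (hQ.isTightMeasureSet_law hdet x) fun l => ?_
    rw [hμ]
    exact hQ.tendsto_laplace_law hdet x l
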